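/- Let $n\ge 0$, let $0<\xi_1<\dots<\xi_n\le 1$ and $g_1,\dots,g_n>0$, and let $g=\sum_{i=1}^n g_i\delta_{\xi_i}$. For $z\in\mathbb C$ let $\phi(\xi;z)$, $0\le\xi\le1$, be the solution of $$-\phi_{\xi\xi\xi}=z\,g\,\phi,\qquad \phi(0)=\phi_\xi(0)=0,\quad \phi_{\xi\xi}(0)=1,$$ and for $a\in\{0,1,2\}$ let $\phi_a^*(\xi;z)$ be the solution of $\phi^*_{\xi\xi\xi}=z\,g\,\phi^*$ whose values $(\phi^*,\phi^*_\xi,\phi^*_{\xi\xi})$ at $\xi=1$ are $(0,0,1)$ for $a=0$, $(0,1,0)$ for $a=1$, and $(1,0,0)$ for $a=2$. (The equations are understood in the sense of distributions; $\phi,\phi_\xi$ are continuous, $\phi_{\xi\xi}$ is taken right-continuous, and $\phi_{\xi\xi}(1)$ is the right-hand limit at $1$, including the jump there if $\xi_n=1$; likewise for $\phi^*_a$.) Let $\sigma_a\subset\mathbb C$ be the spectrum of the boundary value problem of Type $a$, that is, the set of $z$ for which $-f_{\xi\xi\xi}=z\,g\,f$, $f(0)=f_\xi(0)=0$, $\partial_\xi^a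 f(1)=0$ has a nontrivial solution. For $f\in L^2_g[0,1]$ let $$\hat f_a(z)=(-1)^a\int_{[0,1]}\phi_a^*(\xi;z)\,f(\xi)\,dg(\xi)$$ be its generalized Fourier transform of Type $a$. Let $(a,b)\in\{(0,0),(0,1),(1,2),(2,2)\}$; if $\xi_n=1$, only $(a,b)=(2,2)$ is considered. Let $$\alpha=\sum_{x\in\sigma_a}A(x)\,\delta_x,\qquad \beta=\sum_{y\in\sigma_b}B(y)\,\delta_y,$$ where, with $\phi,\phi_\xi,\phi_{\xi\xi}$ and their $z$-derivatives $\phi_z,\phi_{\xi z},\phi_{\xi\xi z}$ evaluated at $\xi=1$ and at the indicated eigenvalue, - $(0,0)$: $A=B=\phi_\xi/\phi_z$; - $(0,1)$: $A=\phi_{\xi\xi}/\phi_z$, $B=-\phi/\phi_{\xi z}$; - $(1,2)$: $A=\phi_{\xi\xi}/\phi_{\xi z}$, $B=-\phi/\phi_{\xi\xi z}$; - $(2,2)$: $A=B=-\phi_\xi/\phi_{\xi\xi z}$. Put $\displaystyle\langle p|q\rangle=\iint\frac{p(x)q(y)}{x+y}\,d\alpha(x)\,d\beta(y)$. Let $\epsilon>0$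 be such that the intervals $(\xi_k-\epsilon,\xi_k+\epsilon)$, $k=1,\dots,n$, are pairwise disjoint, let $\chi_j$ be the indicator function of $(\xi_{n-j}-\epsilon,\xi_{n-j}+\epsilon)$ for $j=0,\dots,n-1$, and let $$p_j=\hat\chi_{a,j},\qquad q_j=\hat\chi_{b,j}$$ be the generalized Fourier transforms of $\chi_j$ of Types $a$ and $b$. Then $\sigma_a$ and $\sigma_b$ are finite sets of positive real numbers and all weights $A(x)$, $B(y)$ are positive, so that $\alpha$ and $\beta$ are finite positive discrete measures on $(0,\infty)$; $p_j$ and $q_j$ are polynomials of degree exactly $j$ with real coefficients for $j=0,\dots,n-1$; and $\{p_j\},\{q_j\}$ are (un-normalized) Cauchy biorthogonal with respect to $\alpha,\beta$: $$\langle p_i|q_j\rangle=0\quad (i\ne j),\qquad \langle p_i|q_i\rangle\ne0 .$$ -/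

import Mathlib

open MeasureTheory

noncomputable section

/-- A discrete cubic string of length `1` with `n` point masses: positive masses `mass i`
at positions `0 < pos 0 < pos 1 < ... < pos (n-1) ≤ 1`.  The degenerate case, with the last
mass placed at the end point `1`, is included here. -/
structure CubicString (n : ℕ) where
  pos : Fin n → ℝ
  mass : Fin n → ℝ
  pos_strictMono : StrictMono pos
  pos_pos : ∀ i, 0 < pos i
  pos_le_one : ∀ i, pos i ≤ 1
  mass_pos : ∀ i, 0 < mass i

namespace CubicString

variable {n : ℕ}

/-- The mass distribution `g = ∑ i, g_i δ_{ξ_i}`. -/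
def g (S : CubicString n) : Measure ℝ :=
  ∑ i, ENNReal.ofReal (S.mass i) • Measure.dirac (S.pos i)

/-- `u x 0 = f(x)`, `u x 1 = f_ξ(x)`, `u x 2 = f_ξξ(x)` for a solution `f` of the
distributional equation `f_ξξξ = w g f` on the string `[0,1]`, in integrated form: `f` and
`f_ξ` are absolutely continuous, `f_ξξ` is the right-continuous representative of the
second derivative, and it has jumps `w g_i f(ξ_i)` at the point masses.  In particular
`u 1 2` is the right-hand limit of the second derivative at `1`, also when a mass sits there. -/
structure Solves (S : CubicString n) (w : ℂ) (u : ℝ → Fin 3 → ℂ) : Prop where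
  eq_zero : ∀ x ∈ Set.Icc (0 : ℝ) 1, u x 0 = u 0 0 + ∫ t in (0 : ℝ)..x, u t 1
  eq_one : ∀ x ∈ Set.Icc (0 : ℝ) 1, u x 1 = u 0 1 + ∫ t in (0 : ℝ)..x, u t 2
  eq_two : ∀ x ∈ Set.Icc (0 : ℝ) 1, u x 2 = u 0 2 + w * ∫ t in Set.Ioc (0 : ℝ) x, u t 0 ∂S.g

/-! Existence of solutions of the initial value problems at `0` and at `1`. -/

theorem setIntegral_g (S : CubicString n) (f : ℝ → ℂ) (s : Set ℝ) [DecidablePred (· ∈ s)]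
    (hs : MeasurableSet s) :
    ∫ t in s, f t ∂S.g = ∑ i, if S.pos i ∈ s then (S.mass i : ℂ) * f (S.pos i) else 0 := by
  rw [← integral_indicator hs, g, integral_finsetSum_measure]
  · refine Finset.sum_congr rfl fun i _ => ?_
    rw [integral_smul_measure, integral_dirac, ENNReal.toReal_ofReal (S.mass_pos i).le,
      Set.indicator_apply]
    split_ifs <;> simp
  · intro i _
    exact (integrable_dirac (by simp)).smul_measure ENNReal.ofReal_ne_top

theorem exists_rec {r : Fin n → Fin n → Prop} (hr : WellFounded r) (a : Fin n → ℂ)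
    (K : Fin n → Fin n → ℂ) (hK : ∀ i k, ¬ r k i → K i k = 0) :
    ∃ c : Fin n → ℂ, ∀ i, c i = a i + ∑ k, K i k * c k := by
  classical
  refine ⟨hr.fix fun i c => a i + ∑ k, if h : r k i then K i k * c k h else 0, fun i => ?_⟩
  rw [hr.fix_eq]
  congr 1
  refine Finset.sum_congr rfl fun k _ => ?_
  split_ifs with h
  · rfl
  · simp [hK i k h]

theorem integral_step (p x : ℝ) (hp : 0 < p) (f : ℝ → ℂ) (hf : Continuous f) :
    IntervalIntegrable (fun t => if p ≤ t then f t else 0) volume 0 x ∧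
    ∫ t in (0 : ℝ)..x, (if p ≤ t then f t else 0) = if p ≤ x then ∫ t in p..x, f t else 0 := by
  have e : (fun t => if p ≤ t then f t else 0) = (Set.Ici p).indicator f := by
    ext t; simp [Set.indicator_apply]
  have hi : ∀ a b, IntervalIntegrable (fun t => if p ≤ t then f t else 0) volume a b := by
    intro a b
    rw [e, intervalIntegrable_iff]
    exact ((intervalIntegrable_iff.1 (hf.intervalIntegrable a b))).indicator measurableSet_Ici
  have hlt : ∀ y, y ≤ p → ∫ t in (0 : ℝ)..y, (if p ≤ t then f t else 0) = 0 := by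
    intro y hy
    refine intervalIntegral.integral_zero_ae ?_
    have : ∀ᵐ t : ℝ, t ≠ p := by simp [ae_iff]
    filter_upwards [this] with t ht hty
    rw [if_neg]
    intro hpt
    rcases Set.mem_uIoc.1 hty with h | h
    · exact ht (le_antisymm (h.2.trans hy) hpt)
    · linarith [h.2]
  refine ⟨hi _ _, ?_⟩
  split_ifs with h
  · rw [← intervalIntegral.integral_add_adjacent_intervals (hi 0 p) (hi p x), hlt p le_rfl,
      zero_add]
    refine intervalIntegral.integral_congr fun t ht => ?_
    rw [Set.uIcc_of_le h] at ht
    simp [ht.1]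
  · exact hlt x (not_le.1 h).le

theorem integral_shift (p x : ℝ) : ∫ t in p..x, ((t - p : ℝ) : ℂ) = ((x - p) ^ 2 / 2 : ℝ) := by
  rw [intervalIntegral.integral_ofReal, intervalIntegral.integral_sub (by simp) (by simp)]
  norm_cast
  rw [integral_id]
  simp
  ring

/-- The piecewise quadratic function with second derivative `q2` near `0` and with jumps
`w g_i c_i` of the second derivative, together with its first two derivatives. -/
def ansatz (S : CubicString n) (w q0 q1 q2 : ℂ) (c : Fin n → ℂ) (x : ℝ) : Fin 3 → ℂ :=
  ![q0 + q1 * x + q2 * (x ^ 2 / 2 : ℝ) + ∑ i, w * S.mass i * c i *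
      (if S.pos i ≤ x then (((x - S.pos i) ^ 2 / 2 : ℝ) : ℂ) else 0),
    q1 + q2 * x + ∑ i, w * S.mass i * c i *
      (if S.pos i ≤ x then ((x - S.pos i : ℝ) : ℂ) else 0),
    q2 + ∑ i, w * S.mass i * c i * (if S.pos i ≤ x then 1 else 0)]

theorem solves_ansatz (S : CubicString n) (w q0 q1 q2 : ℂ) (c : Fin n → ℂ)
    (hc : ∀ i, c i = S.ansatz w q0 q1 q2 c (S.pos i) 0) :
    S.Solves w (S.ansatz w q0 q1 q2 c) := by
  have hneg : ∀ i, ¬ S.pos i ≤ 0 := fun i => not_le.2 (S.pos_pos i)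
  have i1 : ∀ i x, _ := fun i x =>
    integral_step (S.pos i) x (S.pos_pos i) (fun t => ((t - S.pos i : ℝ) : ℂ)) (by fun_prop)
  have i2 : ∀ i x, _ := fun i x =>
    integral_step (S.pos i) x (S.pos_pos i) (fun _ => (1 : ℂ)) (by fun_prop)
  refine ⟨fun x hx => ?_, fun x hx => ?_, fun x hx => ?_⟩
  · simp only [ansatz, Matrix.cons_val]
    rw [intervalIntegral.integral_add, intervalIntegral.integral_finsetSum]
    · simp only [intervalIntegral.integral_const_mul, (i1 _ x).2, integral_shift, hneg, if_false]
      rw [intervalIntegral.integral_add (by simp)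
        ((by fun_prop : Continuous fun t : ℝ => q2 * (t : ℂ)).intervalIntegrable _ _),
        intervalIntegral.integral_const_mul]
      have := integral_shift 0 x
      simp only [sub_zero] at this
      rw [this]
      simp
      ring
    · intro i _
      exact (i1 i x).1.const_mul _
    · exact (by fun_prop : Continuous fun t : ℝ => q1 + q2 * (t : ℂ)).intervalIntegrable _ _
    · have := IntervalIntegrable.sum Finset.univ fun i _ =>
        (i1 i x).1.const_mul (w * S.mass i * c i)
      rw [Finset.sum_fn] at this
      exact this
  · simp only [ansatz, Matrix.cons_val]
    rw [intervalIntegral.integral_add, intervalIntegral.integral_finsetSum]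
    · simp only [intervalIntegral.integral_const_mul, (i2 _ x).2, hneg, if_false]
      simp
      ring
    · intro i _
      exact (i2 i x).1.const_mul _
    · simp
    · have := IntervalIntegrable.sum Finset.univ fun i _ =>
        (i2 i x).1.const_mul (w * S.mass i * c i)
      rw [Finset.sum_fn] at this
      exact this
  · classical
    rw [setIntegral_g S _ _ measurableSet_Ioc]
    simp only [← hc]
    simp only [ansatz, Matrix.cons_val, hneg, if_false, Set.mem_Ioc, S.pos_pos, true_and,
      Finset.mul_sum]
    simp [mul_assoc]

theorem exists_solves_left (S : CubicString n) (w : ℂ) (d : Fin 3 → ℂ) :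
    ∃ u, S.Solves w u ∧ u 0 = d := by
  obtain ⟨c, hc⟩ := exists_rec (r := fun k i : Fin n => k < i) wellFounded_lt
    (fun i => d 0 + d 1 * S.pos i + d 2 * ((S.pos i) ^ 2 / 2 : ℝ))
    (fun i k => w * S.mass k *
      (if S.pos k ≤ S.pos i then (((S.pos i - S.pos k) ^ 2 / 2 : ℝ) : ℂ) else 0)) (by
      intro i k h
      rcases (not_lt.1 h).eq_or_lt with h | h
      · simp [h]
      · rw [if_neg (not_le.2 (S.pos_strictMono h)), mul_zero])
  refine ⟨S.ansatz w (d 0) (d 1) (d 2) c, S.solves_ansatz _ _ _ _ _ fun i => ?_, ?_⟩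
  · rw [hc i]
    simp only [ansatz, Matrix.cons_val]
    congr 1
    exact Finset.sum_congr rfl fun k _ => by ring
  · have hneg : ∀ i, ¬ S.pos i ≤ 0 := fun i => not_le.2 (S.pos_pos i)
    ext j
    fin_cases j <;> simp [ansatz, hneg]

theorem exists_solves_right (S : CubicString n) (w : ℂ) (d : Fin 3 → ℂ) :
    ∃ u, S.Solves w u ∧ u 1 = d := by
  obtain ⟨c, hc⟩ := exists_rec (r := fun k i : Fin n => k > i) wellFounded_gt
    (fun i => d 0 + d 1 * (S.pos i - 1) + d 2 * ((S.pos i - 1) ^ 2 / 2))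
    (fun i k => - (w * S.mass k *
      (if S.pos k ≤ S.pos i then 0 else (((S.pos i - S.pos k) ^ 2 / 2 : ℝ) : ℂ)))) (by
      intro i k h
      rw [if_pos (S.pos_strictMono.monotone (not_lt.1 h)), mul_zero, neg_zero])
  set q2 := d 2 - ∑ k, w * S.mass k * c k with hq2
  set q1 := d 1 - q2 - ∑ k, w * S.mass k * c k * ((1 - S.pos k : ℝ) : ℂ) with hq1
  set q0 := d 0 - q1 - q2 / 2 -
    ∑ k, w * S.mass k * c k * (((1 - S.pos k) ^ 2 / 2 : ℝ) : ℂ) with hq0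
  refine ⟨S.ansatz w q0 q1 q2 c, S.solves_ansatz _ _ _ _ _ fun i => ?_, ?_⟩
  · rw [hc i]
    simp only [ansatz, Matrix.cons_val]
    have h1 : ∀ k, w * S.mass k * c k *
        (if S.pos k ≤ S.pos i then (((S.pos i - S.pos k) ^ 2 / 2 : ℝ) : ℂ) else 0) =
        w * S.mass k * c k * (((1 - S.pos k) ^ 2 / 2 : ℝ) : ℂ)
        + (w * S.mass k * c k * ((1 - S.pos k : ℝ) : ℂ)) * (S.pos i - 1)
        + (w * S.mass k * c k) * ((S.pos i - 1) ^ 2 / 2)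
        + - (w * S.mass k * (if S.pos k ≤ S.pos i then 0 else
          (((S.pos i - S.pos k) ^ 2 / 2 : ℝ) : ℂ))) * c k := by
      intro k
      split_ifs <;> push_cast <;> ring
    simp only [h1, Finset.sum_add_distrib, ← Finset.sum_mul]
    rw [hq0, hq1, hq2]
    push_cast
    ring
  · have hle := S.pos_le_one
    ext j
    fin_cases j <;> simp only [ansatz, hle, if_true] <;> simp [hq0, hq1, hq2] <;> ring

/-- The solution `(φ, φ_ξ, φ_ξξ)(ξ; z)` of `-φ_ξξξ = z g φ` with
`φ(0) = φ_ξ(0) = 0`, `φ_ξξ(0) = 1`. -/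
def phi (S : CubicString n) (z : ℂ) : ℝ → Fin 3 → ℂ :=
  (S.exists_solves_left (-z) ![0, 0, 1]).choose

theorem phi_spec (S : CubicString n) (z : ℂ) :
    S.Solves (-z) (S.phi z) ∧ S.phi z 0 = ![0, 0, 1] :=
  (S.exists_solves_left (-z) ![0, 0, 1]).choose_spec

/-- The initial values `(φ*, φ*_ξ, φ*_ξξ)(1)` of the adjoint problem of type `a`. -/
def adjointInit : Fin 3 → Fin 3 → ℂ
  | 0 => ![0, 0, 1]
  | 1 => ![0, 1, 0]
  | 2 => ![1, 0, 0]

/-- The solution `(φ*_a, φ*_{a,ξ}, φ*_{a,ξξ})(ξ; z)` of the adjoint initial value problem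
`φ*_ξξξ = z g φ*` of type `a`, with initial values prescribed at `1`. -/
def phiStar (S : CubicString n) (a : Fin 3) (z : ℂ) : ℝ → Fin 3 → ℂ :=
  (S.exists_solves_right z (adjointInit a)).choose

theorem phiStar_spec (S : CubicString n) (a : Fin 3) (z : ℂ) :
    S.Solves z (S.phiStar a z) ∧ S.phiStar a z 1 = adjointInit a :=
  (S.exists_solves_right z (adjointInit a)).choose_spec

/-- The spectrum of the boundary value problem of type `a`: `-f_ξξξ = z g f`,
`f(0) = f_ξ(0) = 0`, and the derivative of order `a` of `f` vanishes at `1`. -/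
def spectrum (S : CubicString n) (a : Fin 3) : Set ℂ :=
  {z | ∃ u, S.Solves (-z) u ∧ u 0 0 = 0 ∧ u 0 1 = 0 ∧ u 1 a = 0 ∧
    ∃ x ∈ Set.Icc (0 : ℝ) 1, u x 0 ≠ 0}

/-- The generalized Fourier transform of type `a`:
`(-1)^a ∫_[0,1] φ*_a(ξ; z) f(ξ) dg(ξ)`. -/
def fourier (S : CubicString n) (a : Fin 3) (f : ℝ → ℂ) (z : ℂ) : ℂ :=
  (-1) ^ (a : ℕ) * ∫ x in Set.Icc (0 : ℝ) 1, S.phiStar a z x 0 * f x ∂S.g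

/-- The residue `N(z) / ∂_z φ^(a)(1; z)` of the Weyl function `N / φ^(a)(1; ·)` at an
eigenvalue `z` of type `a`, where `φ^(a)` is the `ξ`-derivative of order `a`. -/
def weight (S : CubicString n) (a : Fin 3) (N : ℂ → ℂ) (z : ℂ) : ℂ :=
  N z / deriv (fun y => S.phi y 1 a) z

/-- The discrete measure `∑ N(x) / (∂_z φ^(a)(1; x)) δ_x` over the eigenvalues `x` of
type `a`, whose Stieltjes transform is the Weyl function `N(z) / φ^(a)(1; z)`. -/
def spectralMeasure (S : CubicString n) (a : Fin 3) (N : ℂ → ℂ) : Measure ℝ :=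
  Measure.sum fun x : {x : ℝ // (x : ℂ) ∈ S.spectrum a} =>
    ENNReal.ofReal (S.weight a N (x : ℝ)).re • Measure.dirac (x : ℝ)

end CubicString

/-- The pairs `a b` of types of boundary value problems for which the inner products
`(φ_{a,i}, φ_{b,j})_g` of the eigenfunctions factorize. -/
inductive TypePair
  | t00
  | t01
  | t12
  | t22

namespace TypePair

/-- The first type `a` of the pair. -/
def fst : TypePair → Fin 3
  | t00 => 0
  | t01 => 0
  | t12 => 1
  | t22 => 2

/-- The second type `b` of the pair. -/
def snd : TypePair → Fin 3
  | t00 => 0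
  | t01 => 1
  | t12 => 2
  | t22 => 2

/-- The numerator of the Weyl function generating `α`:
`φ_ξ/φ`, `φ_ξξ/φ`, `φ_ξξ/φ_ξ`, `-φ_ξ/φ_ξξ` at `ξ = 1`, respectively. -/
def numA {n : ℕ} (S : CubicString n) : TypePair → ℂ → ℂ
  | t00 => fun z => S.phi z 1 1
  | t01 => fun z => S.phi z 1 2
  | t12 => fun z => S.phi z 1 2
  | t22 => fun z => -S.phi z 1 1

/-- The numerator of the Weyl function generating `β`:
`φ_ξ/φ`, `-φ/φ_ξ`, `-φ/φ_ξξ`, `-φ_ξ/φ_ξξ` at `ξ = 1`, respectively. -/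
def numB {n : ℕ} (S : CubicString n) : TypePair → ℂ → ℂ
  | t00 => fun z => S.phi z 1 1
  | t01 => fun z => -S.phi z 1 0
  | t12 => fun z => -S.phi z 1 0
  | t22 => fun z => -S.phi z 1 1

end TypePair

namespace CubicString

variable {n : ℕ}

/-- The measure `α` of the pair of types `T`. -/
def alpha (S : CubicString n) (T : TypePair) : Measure ℝ := S.spectralMeasure T.fst (T.numA S)

/-- The measure `β` of the pair of types `T`. -/
def beta (S : CubicString n) (T : TypePair) : Measure ℝ := S.spectralMeasure T.snd (T.numB S)

/-- The pairing `⟨p|q⟩ = ∫∫ p(x) q(y) / (x + y) dα(x) dβ(y)`. -/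
def pairing (S : CubicString n) (T : TypePair) (p q : ℂ → ℂ) : ℂ :=
  ∫ x : ℝ, ∫ y : ℝ, p x * q y / ((x : ℂ) + (y : ℂ)) ∂(S.beta T) ∂(S.alpha T)

/-- The interval `(ξ_{n-j} - ε, ξ_{n-j} + ε)`, for `j = 0, ..., n - 1`; masses are counted
from the right end. -/
def window (S : CubicString n) (ε : ℝ) (j : Fin n) : Set ℝ :=
  Set.Ioo (S.pos j.rev - ε) (S.pos j.rev + ε)

/-- The indicator function `χ_j` of the interval around `ξ_{n-j}`. -/
def chi (S : CubicString n) (ε : ℝ) (j : Fin n) : ℝ → ℂ :=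
  (S.window ε j).indicator fun _ => 1

end CubicString

end

/-!
Between two masses a solution moves by the flow of `f''' = 0`, and each mass adds an impulse
proportional to the value of the solution there. So the values at the masses solve a triangular
system, which makes them polynomials in `z` of known degree.

Consider an alternating form on polynomials that is nonnegative on all pairs `(z f, f)`. The
components `φ, φ_ξ, φ_ξξ` satisfy positivity relations under it just to the right of `0`, and both
the flow and the impulses preserve them. Applied to `Im (f(z) * conj g(z))` this shows that the
spectrum is real, applied to the Wronskian at a real point that the weights are positive.

Lagrange's identity for the concomitant `f'' g - f' g' + f g''` is used twice. Comparing `φ` with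
`φ*_a` it gives the Fourier transforms of the eigenfunctions, and hence an inversion formula, as
there are as many simple eigenvalues as masses. Comparing `φ(·; x)` with `φ(·; y)` it writes the
product of the numerators of `α` and `β` as `(x + y) ∫ φ(ξ; x) φ(ξ; y) dg(ξ)`, which cancels the
Cauchy kernel. Therefore the pairing of the transforms of `f` and `h` is `∫ f h dg`, which vanishes
if `f` and `h` have disjoint supports.
-/

noncomputable section

namespace CubicString

open Polynomial
open scoped ComplexConjugate ComplexOrder

variable {n : ℕ}

section Drift

variable {A B : Type*} [CommRing A] [Algebra ℝ A] [CommRing B] [Algebra ℝ B]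

/-- The flow of `f''' = 0` after time `t`, acting on the vector `(f, f', f'')`: what a cubic string
does between two masses. The entries may lie in any real algebra, so that the same map serves
numerical solutions and solutions that are polynomials in the spectral parameter. -/
def drift (t : ℝ) : (Fin 3 → A) →ₗ[A] (Fin 3 → A) where
  toFun v := ![v 0 + t • v 1 + (t ^ 2 / 2) • v 2, v 1 + t • v 2, v 2]
  map_add' u v := by
    ext j
    fin_cases j <;> simp <;> abel
  map_smul' c v := by
    ext j
    fin_cases j <;> simp [mul_add]

theorem drift_apply (t : ℝ) (v : Fin 3 → A) :
    drift t v = ![v 0 + t • v 1 + (t ^ 2 / 2) • v 2, v 1 + t • v 2, v 2] :=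
  rfl

theorem drift_drift (s t : ℝ) (v : Fin 3 → A) : drift s (drift t v) = drift (s + t) v := by
  ext j
  fin_cases j <;> simp [drift_apply] <;> module

theorem map_drift (F : A →ₐ[ℝ] B) (t : ℝ) (v : Fin 3 → A) (j : Fin 3) :
    F (drift t v j) = drift t (fun i => F (v i)) j := by
  fin_cases j <;> simp [drift_apply]

end Drift

section Duhamel

theorem intervalIntegral_add_sum_ite (p : Fin n → ℝ) (hp : ∀ i, 0 < p i) (e : Fin n → ℂ)
    (f : ℝ → ℂ) (hf : Continuous f) (F : Fin n → ℝ → ℂ) (hF : ∀ i, Continuous (F i)) (x : ℝ) :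
    ∫ t in (0 : ℝ)..x, (f t + ∑ i, e i * if p i ≤ t then F i t else 0) =
      (∫ t in (0 : ℝ)..x, f t) + ∑ i, e i * if p i ≤ x then ∫ t in p i..x, F i t else 0 := by
  have hi : ∀ i, IntervalIntegrable (fun t => e i * if p i ≤ t then F i t else 0) volume 0 x :=
    fun i => (integral_step (p i) x (hp i) (F i) (hF i)).1.const_mul _
  rw [intervalIntegral.integral_add (hf.intervalIntegrable _ _)
      (by simpa only [Finset.sum_fn] using IntervalIntegrable.sum Finset.univ fun i _ => hi i),
    intervalIntegral.integral_finsetSum fun i _ => hi i]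
  simp only [intervalIntegral.integral_const_mul, (integral_step _ x (hp _) _ (hF _)).2]

variable {S : CubicString n} {w : ℂ} {u : ℝ → Fin 3 → ℂ} {x y : ℝ}

theorem pos_mem (S : CubicString n) (i : Fin n) : S.pos i ∈ Set.Icc (0 : ℝ) 1 :=
  ⟨(S.pos_pos i).le, S.pos_le_one i⟩

theorem Solves.apply_two (h : S.Solves w u) (hx : x ∈ Set.Icc (0 : ℝ) 1) :
    u x 2 = u 0 2 + ∑ i, w * S.mass i * u (S.pos i) 0 * if S.pos i ≤ x then 1 else 0 := by
  classical
  rw [h.eq_two x hx, setIntegral_g S _ _ measurableSet_Ioc, Finset.mul_sum]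
  congr 1
  refine Finset.sum_congr rfl fun i _ => ?_
  simp only [Set.mem_Ioc, S.pos_pos, true_and, mul_ite, mul_zero, mul_one, mul_assoc]

theorem Solves.apply_one (h : S.Solves w u) (hx : x ∈ Set.Icc (0 : ℝ) 1) :
    u x 1 = u 0 1 + x * u 0 2 + ∑ i, w * S.mass i * u (S.pos i) 0 *
      if S.pos i ≤ x then ((x - S.pos i : ℝ) : ℂ) else 0 := by
  have hu : ∀ t ∈ Set.uIcc 0 x, u t 2 = _ := fun t ht =>
    h.apply_two (Set.Icc_subset_Icc_right hx.2 (Set.uIcc_of_le hx.1 ▸ ht))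
  rw [h.eq_one x hx, intervalIntegral.integral_congr hu, intervalIntegral_add_sum_ite S.pos
    S.pos_pos _ _ continuous_const (fun _ _ => 1) fun _ => continuous_const]
  simp [add_assoc]

theorem Solves.apply_zero (h : S.Solves w u) (hx : x ∈ Set.Icc (0 : ℝ) 1) :
    u x 0 = u 0 0 + x * u 0 1 + (x ^ 2 / 2 : ℝ) * u 0 2 +
      ∑ i, w * S.mass i * u (S.pos i) 0 *
        if S.pos i ≤ x then (((x - S.pos i) ^ 2 / 2 : ℝ) : ℂ) else 0 := by
  have hu : ∀ t ∈ Set.uIcc 0 x, u t 1 = _ := fun t ht =>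
    h.apply_one (Set.Icc_subset_Icc_right hx.2 (Set.uIcc_of_le hx.1 ▸ ht))
  have hfree : ∫ t in (0 : ℝ)..x, (u 0 1 + t * u 0 2) =
      x * u 0 1 + (x ^ 2 / 2 : ℝ) * u 0 2 := by
    have := integral_shift 0 x
    simp only [sub_zero] at this
    rw [intervalIntegral.integral_add (by simp)
      ((by fun_prop : Continuous fun t : ℝ => (t : ℂ) * u 0 2).intervalIntegrable _ _),
      intervalIntegral.integral_mul_const, this]
    simp
  rw [h.eq_zero x hx, intervalIntegral.integral_congr hu, intervalIntegral_add_sum_ite S.pos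
    S.pos_pos _ _ (by fun_prop) (fun i t => ((t - S.pos i : ℝ) : ℂ)) fun _ => by fun_prop, hfree]
  simp only [integral_shift, add_assoc]

theorem Solves.eq_drift_zero_add_sum (h : S.Solves w u) (hx : x ∈ Set.Icc (0 : ℝ) 1) :
    u x = drift x (u 0) + ∑ i, (if S.pos i ≤ x then w * S.mass i * u (S.pos i) 0 else 0) •
      drift (x - S.pos i) ![0, 0, 1] := by
  ext j
  fin_cases j
  · simp [drift_apply, h.apply_zero hx, ite_apply]
  · simp [drift_apply, h.apply_one hx, ite_apply]
  · simp [drift_apply, h.apply_two hx, ite_apply]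

/-- Duhamel's formula between two arbitrary points: each mass crossed on the way from `x` to `y`
emits an impulse, counted negatively when moving to the left. -/
theorem Solves.duhamel (h : S.Solves w u) (hx : x ∈ Set.Icc (0 : ℝ) 1)
    (hy : y ∈ Set.Icc (0 : ℝ) 1) :
    u y = drift (y - x) (u x) +
      ∑ i, (((if S.pos i ≤ y then 1 else 0) - (if S.pos i ≤ x then 1 else 0)) *
        (w * S.mass i * u (S.pos i) 0)) • drift (y - S.pos i) ![0, 0, 1] := by
  rw [h.eq_drift_zero_add_sum hx, h.eq_drift_zero_add_sum hy]
  simp only [map_add, map_sum, map_smul, drift_drift, sub_add_cancel, sub_add_sub_cancel]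
  rw [add_assoc, ← Finset.sum_add_distrib]
  congr 1
  refine Finset.sum_congr rfl fun i _ => ?_
  rw [← add_smul]
  congr 1
  split_ifs <;> ring

theorem Solves.apply_pos_eq_sum_Iio (h : S.Solves w u) (j : Fin n) :
    u (S.pos j) 0 = drift (S.pos j) (u 0) 0 +
      w * ∑ k ∈ Finset.Iio j, (S.mass k * (S.pos j - S.pos k) ^ 2 / 2 : ℝ) * u (S.pos k) 0 := by
  have := congrFun (h.duhamel ⟨le_rfl, zero_le_one⟩ (S.pos_mem j)) 0
  rw [this, sub_zero, Pi.add_apply, Finset.sum_apply, Finset.mul_sum]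
  congr 1
  rw [← Finset.sum_subset (Finset.subset_univ (Finset.Iio j))]
  · refine Finset.sum_congr rfl fun k hk => ?_
    have hkj := (S.pos_strictMono (Finset.mem_Iio.1 hk)).le
    simp only [hkj, (S.pos_pos k).not_ge, if_true, if_false, drift_apply, Pi.smul_apply,
      Matrix.cons_val, smul_zero, smul_eq_mul, Complex.real_smul]
    push_cast
    ring
  · intro k _ hk
    rcases (not_lt.1 (Finset.mem_Iio.not.1 hk)).eq_or_lt with rfl | hjk
    · simp [drift_apply]
    · simp [(S.pos_strictMono hjk).not_ge, (S.pos_pos k).not_ge]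

theorem Solves.apply_pos_eq_sum_Ioi (h : S.Solves w u) (j : Fin n) :
    u (S.pos j) 0 = drift (S.pos j - 1) (u 1) 0 -
      w * ∑ k ∈ Finset.Ioi j, (S.mass k * (S.pos j - S.pos k) ^ 2 / 2 : ℝ) * u (S.pos k) 0 := by
  have := congrFun (h.duhamel ⟨zero_le_one, le_rfl⟩ (S.pos_mem j)) 0
  rw [this, Pi.add_apply, Finset.sum_apply, Finset.mul_sum, sub_eq_add_neg (drift _ _ _),
    ← Finset.sum_neg_distrib]
  congr 1
  rw [← Finset.sum_subset (Finset.subset_univ (Finset.Ioi j))]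
  · refine Finset.sum_congr rfl fun k hk => ?_
    have hjk := S.pos_strictMono (Finset.mem_Ioi.1 hk)
    simp only [hjk.not_ge, S.pos_le_one k, if_true, if_false, drift_apply, Pi.smul_apply,
      Matrix.cons_val, smul_zero, smul_eq_mul, Complex.real_smul]
    push_cast
    ring
  · intro k _ hk
    have hkj := S.pos_strictMono.monotone (not_lt.1 (Finset.mem_Ioi.not.1 hk))
    simp [hkj, S.pos_le_one k]

end Duhamel

section Gaps

variable {S : CubicString n} {a b x : ℝ} {w w' z : ℂ} {u v : ℝ → Fin 3 → ℂ}

theorem integral_g (S : CubicString n) (f : ℝ → ℂ) :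
    ∫ x, f x ∂S.g = ∑ i, (S.mass i : ℂ) * f (S.pos i) := by
  classical
  simpa using setIntegral_g S f Set.univ MeasurableSet.univ

/-- An interval `[a, b] ⊆ [0, 1]` without masses in its interior. Masses at the end points are
allowed, so that the string is cut into consecutive gaps. -/
structure IsGap (S : CubicString n) (a b : ℝ) : Prop where
  nonneg : 0 ≤ a
  lt : a < b
  le_one : b ≤ 1
  gap : ∀ i, S.pos i ≤ a ∨ b ≤ S.pos i

theorem IsGap.mem_left (h : S.IsGap a b) : a ∈ Set.Icc (0 : ℝ) 1 :=
  ⟨h.nonneg, h.lt.le.trans h.le_one⟩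

theorem IsGap.mem_right (h : S.IsGap a b) : b ∈ Set.Icc (0 : ℝ) 1 :=
  ⟨h.nonneg.trans h.lt.le, h.le_one⟩

theorem exists_isGap (S : CubicString n) (hx : x ∈ Set.Ioc (0 : ℝ) 1) :
    ∃ a, S.IsGap a x ∧ (a = 0 ∨ ∃ i, S.pos i = a) := by
  classical
  rcases (Finset.univ.filter fun i => S.pos i < x).eq_empty_or_nonempty with hempty | hne
  · simp only [Finset.filter_eq_empty_iff, Finset.mem_univ, true_imp_iff, not_lt] at hempty
    exact ⟨0, ⟨le_rfl, hx.1, hx.2, fun i => Or.inr (hempty (x := i))⟩, Or.inl rfl⟩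
  · obtain ⟨i, hi, hmax⟩ := Finset.exists_max_image _ S.pos hne
    simp only [Finset.mem_filter, Finset.mem_univ, true_and] at hi hmax
    exact ⟨S.pos i, ⟨(S.pos_pos i).le, hi, hx.2, fun k => (lt_or_ge (S.pos k) x).imp_left (hmax k)⟩,
      Or.inr ⟨i, rfl⟩⟩

theorem isGap_induction (S : CubicString n) {P : ℝ → Prop} (h0 : P 0)
    (hgap : ∀ a b, S.IsGap a b → P a → P b) : ∀ x ∈ Set.Icc (0 : ℝ) 1, P x := by
  have hstep : ∀ x ∈ Set.Icc (0 : ℝ) 1, (∀ i, S.pos i < x → P (S.pos i)) → P x := by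
    intro x hx hleft
    rcases hx.1.eq_or_lt with rfl | hx0
    · exact h0
    obtain ⟨a, hax, rfl | ⟨i, rfl⟩⟩ := S.exists_isGap ⟨hx0, hx.2⟩
    · exact hgap _ _ hax h0
    · exact hgap _ _ hax (hleft i hax.lt)
  have hpos : ∀ i, P (S.pos i) := by
    intro i
    induction i using WellFoundedLT.induction with
    | ind i ih => exact hstep _ (S.pos_mem i) fun k hk => ih k (S.pos_strictMono.lt_iff_lt.1 hk)
  exact fun x hx => hstep x hx fun i _ => hpos i

theorem isGap_induction_Ioc (S : CubicString n) {P : ℝ → Prop}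
    (h0 : ∀ b, S.IsGap 0 b → P b) (hgap : ∀ a b, S.IsGap a b → P a → P b) :
    ∀ x ∈ Set.Ioc (0 : ℝ) 1, P x := by
  suffices h : ∀ x ∈ Set.Icc (0 : ℝ) 1, 0 < x → P x from fun x hx => h x ⟨hx.1.le, hx.2⟩ hx.1
  refine S.isGap_induction (fun h => absurd h (lt_irrefl 0)) fun a b hab ih _ => ?_
  rcases hab.nonneg.eq_or_lt with rfl | ha
  · exact h0 b hab
  · exact hgap a b hab (ih ha)

theorem IsGap.setIntegral_Ioc (h : S.IsGap a b) (f : ℝ → ℂ) :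
    ∫ t in Set.Ioc 0 b, f t ∂S.g = (∫ t in Set.Ioc 0 a, f t ∂S.g) + S.g.real {b} * f b := by
  classical
  have hb : (S.g.real {b} : ℂ) * f b = ∫ t in {b}, f t ∂S.g := by
    rw [integral_singleton, Complex.real_smul]
  rw [hb]
  simp only [setIntegral_g S f, measurableSet_Ioc, measurableSet_singleton,
    ← Finset.sum_add_distrib]
  refine Finset.sum_congr rfl fun i _ => ?_
  simp only [Set.mem_Ioc, S.pos_pos, true_and, Set.mem_singleton_iff]
  rcases h.gap i with hi | hi
  · simp [hi, hi.trans h.lt.le, (hi.trans_lt h.lt).ne]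
  · simp [(h.lt.trans_le hi).not_ge, hi.ge_iff_eq']

theorem Solves.step (h : S.Solves w u) (hab : S.IsGap a b) :
    u b = drift (b - a) (u a) + ![0, 0, w * S.g.real {b} * u b 0] := by
  have key := h.duhamel hab.mem_left hab.mem_right
  have htwo := h.eq_two b hab.mem_right
  rw [hab.setIntegral_Ioc, mul_add, ← add_assoc, ← h.eq_two a hab.mem_left, ← mul_assoc] at htwo
  have hjump : ∀ i, S.pos i ≠ b →
      ((if S.pos i ≤ b then 1 else 0) - (if S.pos i ≤ a then 1 else 0) : ℂ) = 0 := by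
    intro i hi
    rcases hab.gap i with hia | hbi
    · simp [hia, hia.trans hab.lt.le]
    · simp [(hab.lt.trans_le hbi).not_ge, (lt_of_le_of_ne hbi hi.symm).not_ge]
  have hsum : ∀ j : Fin 3, j ≠ 2 → u b j = drift (b - a) (u a) j := by
    intro j hj
    rw [key, Pi.add_apply, Finset.sum_apply, Finset.sum_eq_zero, add_zero]
    intro i _
    by_cases hi : S.pos i = b
    · fin_cases j <;> simp_all [drift_apply]
    · simp [hjump i hi]
  ext j
  fin_cases j
  · simpa using hsum 0 (by decide)
  · simpa using hsum 1 (by decide)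
  · simpa [drift_apply] using htwo

theorem Solves.ext (hu : S.Solves w u) (hv : S.Solves w v) (h0 : u 0 = v 0)
    (hx : x ∈ Set.Icc (0 : ℝ) 1) : u x = v x := by
  refine S.isGap_induction (P := fun x => u x = v x) h0 (fun a b hab ih => ?_) x hx
  have hb : u b 0 = v b 0 := by rw [hu.step hab, hv.step hab, ih]; simp
  rw [hu.step hab, hv.step hab, ih, hb]

theorem Solves.smul (h : S.Solves w u) (c : ℂ) : S.Solves w (fun x => c • u x) where
  eq_zero x hx := by
    simp only [Pi.smul_apply, smul_eq_mul, intervalIntegral.integral_const_mul]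
    rw [h.eq_zero x hx, mul_add]
  eq_one x hx := by
    simp only [Pi.smul_apply, smul_eq_mul, intervalIntegral.integral_const_mul]
    rw [h.eq_one x hx, mul_add]
  eq_two x hx := by
    simp only [Pi.smul_apply, smul_eq_mul, integral_const_mul]
    rw [h.eq_two x hx, mul_add, mul_left_comm]

theorem Solves.eq_smul_phi (h : S.Solves (-z) u) (h0 : u 0 0 = 0) (h1 : u 0 1 = 0)
    (hx : x ∈ Set.Icc (0 : ℝ) 1) : u x = u 0 2 • S.phi z x := by
  refine h.ext ((S.phi_spec z).1.smul (u 0 2)) ?_ hx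
  ext j
  fin_cases j <;> simp [(S.phi_spec z).2, h0, h1]

theorem exists_phi_ne_zero (S : CubicString n) (z : ℂ) :
    ∃ x ∈ Set.Icc (0 : ℝ) 1, S.phi z x 0 ≠ 0 := by
  by_contra! hphi
  have hone := congrFun ((S.phi_spec z).1.eq_drift_zero_add_sum (x := 1) (by simp)) 0
  simp [hphi 1 (by simp), hphi _ (S.pos_mem _), (S.phi_spec z).2, drift_apply] at hone

theorem mem_spectrum_iff {j : Fin 3} : z ∈ S.spectrum j ↔ S.phi z 1 j = 0 := by
  constructor
  · rintro ⟨u, hu, h0, h1, hj, x, hx, hne⟩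
    rw [hu.eq_smul_phi h0 h1 (by simp), Pi.smul_apply] at hj
    rw [hu.eq_smul_phi h0 h1 hx, Pi.smul_apply] at hne
    exact (smul_eq_zero.1 hj).resolve_left (left_ne_zero_of_smul hne)
  · intro h
    obtain ⟨hsolves, hinit⟩ := S.phi_spec z
    exact ⟨_, hsolves, by simp [hinit], by simp [hinit], h, S.exists_phi_ne_zero z⟩

/-- The bilinear concomitant of `f''' = w g f` and `f''' = w' g f`, which plays the role of the
Wronskian of a second order equation in Lagrange's identity. -/
def concomitant (u v : Fin 3 → ℂ) : ℂ :=
  u 2 * v 0 - u 1 * v 1 + u 0 * v 2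

theorem concomitant_drift (t : ℝ) (u v : Fin 3 → ℂ) :
    concomitant (drift t u) (drift t v) = concomitant u v := by
  simp only [concomitant, drift_apply, Matrix.cons_val, Complex.real_smul]
  push_cast
  ring

theorem Solves.lagrange_Ioc (hu : S.Solves w u) (hv : S.Solves w' v)
    (hx : x ∈ Set.Icc (0 : ℝ) 1) :
    concomitant (u x) (v x) = concomitant (u 0) (v 0) +
      (w + w') * ∫ t in Set.Ioc 0 x, u t 0 * v t 0 ∂S.g := by
  refine S.isGap_induction (P := fun x => concomitant (u x) (v x) = concomitant (u 0) (v 0) +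
    (w + w') * ∫ t in Set.Ioc 0 x, u t 0 * v t 0 ∂S.g) (by simp) (fun a b hab ih => ?_) x hx
  have hjump : ∀ (p q : Fin 3 → ℂ) (s t : ℂ), concomitant (p + ![0, 0, s]) (q + ![0, 0, t]) =
      concomitant p q + s * q 0 + p 0 * t := by
    intro p q s t
    simp only [concomitant, Pi.add_apply, Matrix.cons_val, add_zero]
    ring
  have hu0 : u b 0 = drift (b - a) (u a) 0 := by rw [hu.step hab]; simp
  have hv0 : v b 0 = drift (b - a) (v a) 0 := by rw [hv.step hab]; simp
  rw [hab.setIntegral_Ioc]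
  conv_lhs => rw [hu.step hab, hv.step hab, hjump, concomitant_drift, ih, ← hu0, ← hv0]
  ring

theorem Solves.lagrange (hu : S.Solves w u) (hv : S.Solves w' v) :
    concomitant (u 1) (v 1) = concomitant (u 0) (v 0) +
      (w + w') * ∑ i, S.mass i * (u (S.pos i) 0 * v (S.pos i) 0) := by
  classical
  rw [hu.lagrange_Ioc hv (by simp), setIntegral_g S _ _ measurableSet_Ioc]
  simp [S.pos_pos, S.pos_le_one]

end Gaps

section Triangular

variable {R A : Type*} [CommRing R] [CommRing A] [Algebra R A]

theorem degree_C_add_X_mul_sum [IsDomain R] {m : ℕ} (hm : m ≤ n) {p : Fin n → R[X]}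
    (hp : ∀ k : Fin n, (k : ℕ) < m → (p k).degree = (k : ℕ)) {h : Fin n → R}
    (hh : ∀ k : Fin n, (k : ℕ) < m → h k ≠ 0) {a : R} (ha : m = 0 → a ≠ 0) :
    (C a + X * ∑ k with (k : Fin n).val < m, C (h k) * p k).degree = (m : WithBot ℕ) := by
  rcases m with _ | m
  · simp [degree_C (ha rfl)]
  have hdegree : ∀ k : Fin n, (k : ℕ) < m + 1 → (C (h k) * p k).degree = (k : ℕ) := fun k hk => by
    rw [degree_C_mul (hh k hk), hp k hk]
  have hsum : (∑ k with (k : Fin n).val < m + 1, C (h k) * p k).degree = (m : WithBot ℕ) := by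
    rw [degree_sum_eq_of_disjoint]
    · refine le_antisymm (Finset.sup_le fun k hk => ?_) ?_
      · have hk' := (Finset.mem_filter.1 hk).2
        rw [hdegree k hk']
        exact_mod_cast Nat.lt_succ_iff.1 hk'
      · rw [← hdegree ⟨m, hm⟩ (Nat.lt_succ_self m)]
        exact Finset.le_sup (f := fun k => (C (h k) * p k).degree) (by simp)
    · rintro k ⟨hk, -⟩ l ⟨hl, -⟩ hkl heq
      simp only [Finset.mem_filter, Finset.mem_univ, true_and] at hk hl
      simp only [Function.comp_apply, hdegree k hk, hdegree l hl] at heq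
      exact hkl (Fin.ext (by exact_mod_cast heq))
  have hX : (X * ∑ k with (k : Fin n).val < m + 1, C (h k) * p k).degree =
      ((m + 1 : ℕ) : WithBot ℕ) := by
    rw [degree_mul, degree_X, hsum, add_comm]
    rfl
  rw [degree_add_eq_right_of_degree_lt, hX]
  rw [hX]
  exact degree_C_le.trans_lt (by exact_mod_cast m.succ_pos)

/-- The polynomials in `z` solving the triangular system `c j = a j + z ∑ k < j, K j k * c k`. -/
def triangularPoly (a : Fin n → R) (K : Fin n → Fin n → R) (j : Fin n) : R[X] :=
  C (a j) + X * ∑ k : Finset.Iio j, C (K j k) * triangularPoly a K k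
termination_by j
decreasing_by exact Fin.lt_def.1 (Finset.mem_Iio.1 k.2)

variable {a : Fin n → R} {K : Fin n → Fin n → R}

theorem triangularPoly_eq (j : Fin n) : triangularPoly a K j =
    C (a j) + X * ∑ k ∈ Finset.Iio j, C (K j k) * triangularPoly a K k := by
  rw [triangularPoly, Finset.sum_coe_sort (Finset.Iio j) fun k => C (K j k) * triangularPoly a K k]

theorem degree_triangularPoly [IsDomain R] (ha : ∀ j, a j ≠ 0) (hK : ∀ j, ∀ k < j, K j k ≠ 0)
    (j : Fin n) : (triangularPoly a K j).degree = (j : ℕ) := by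
  induction j using WellFoundedLT.induction with
  | ind j ih =>
    have hIio : Finset.Iio j = Finset.univ.filter fun k : Fin n => (k : ℕ) < j := by ext; simp
    rw [triangularPoly_eq, hIio]
    exact degree_C_add_X_mul_sum j.2.le ih (hK j) fun _ => ha j

theorem aeval_triangularPoly {z : A} {c : Fin n → A}
    (hc : ∀ j, c j =
      algebraMap R A (a j) + z * ∑ k ∈ Finset.Iio j, algebraMap R A (K j k) * c k) (j : Fin n) :
    aeval z (triangularPoly a K j) = c j := by
  induction j using WellFoundedLT.induction with
  | ind j ih =>
    rw [triangularPoly_eq, hc]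
    simp only [map_add, map_mul, map_sum, aeval_C, aeval_X]
    congr 2
    exact Finset.sum_congr rfl fun k hk => by rw [ih k (Finset.mem_Iio.1 hk)]

end Triangular

section SolutionPolynomials

variable {S : CubicString n} {a b x : ℝ} {z : ℂ}

theorem eq_of_forall_aeval_eq {p q : ℝ[X]} (h : ∀ z : ℂ, aeval z p = aeval z q) : p = q := by
  refine Polynomial.map_injective _ (algebraMap ℝ ℂ).injective (Polynomial.funext fun z => ?_)
  simpa only [eval_map_algebraMap] using h z

theorem drift_impulse_ne_zero {t : ℝ} {j : Fin 3} (h : j = 2 ∨ t ≠ 0) :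
    drift t (![0, 0, 1] : Fin 3 → ℝ) j ≠ 0 := by
  fin_cases j <;> simp_all [drift_apply]

theorem drift_impulse_pos {t : ℝ} (ht : 0 < t) (j : Fin 3) :
    0 < drift t (![0, 0, 1] : Fin 3 → ℝ) j := by
  have hpow : 0 < t ^ 2 := by positivity
  fin_cases j <;> simp [drift_apply, ht, hpow]

theorem drift_impulse_eq_algebraMap {A : Type*} [CommRing A] [Algebra ℝ A] (t : ℝ) (j : Fin 3) :
    drift t (![0, 0, 1] : Fin 3 → A) j =
      algebraMap ℝ A (drift t (![0, 0, 1] : Fin 3 → ℝ) j) := by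
  fin_cases j <;> simp [drift_apply, Algebra.smul_def]

/-- The value `φ(ξ_j; z)` at the `j`-th mass as a polynomial in `z`. -/
def massPoly (S : CubicString n) : Fin n → ℝ[X] :=
  triangularPoly (fun j => drift (S.pos j) (![0, 0, 1] : Fin 3 → ℝ) 0)
    fun j k => -(S.mass k * (S.pos j - S.pos k) ^ 2 / 2)

theorem degree_massPoly (S : CubicString n) (j : Fin n) : (S.massPoly j).degree = (j : ℕ) :=
  degree_triangularPoly (fun i => drift_impulse_ne_zero (Or.inr (S.pos_pos i).ne'))
    (fun i k hk => by
      have := sub_ne_zero.2 (S.pos_strictMono hk).ne'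
      have := (S.mass_pos k).ne'
      exact neg_ne_zero.2 (by positivity)) j

theorem aeval_massPoly (S : CubicString n) (j : Fin n) (z : ℂ) :
    aeval z (S.massPoly j) = S.phi z (S.pos j) 0 := by
  refine aeval_triangularPoly (c := fun j => S.phi z (S.pos j) 0) (fun i => ?_) j
  rw [(S.phi_spec z).1.apply_pos_eq_sum_Iio, (S.phi_spec z).2, drift_impulse_eq_algebraMap,
    neg_mul, ← mul_neg, ← Finset.sum_neg_distrib]
  simp

/-- The vector `(φ, φ_ξ, φ_ξξ)(x; z)` as polynomials in `z`. -/
def phiPoly (S : CubicString n) (x : ℝ) : Fin 3 → ℝ[X] :=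
  drift x ![0, 0, 1] + ∑ i, (if S.pos i ≤ x then -(X * C (S.mass i) * S.massPoly i) else 0) •
    drift (x - S.pos i) ![0, 0, 1]

theorem aeval_phiPoly (S : CubicString n) (hx : x ∈ Set.Icc (0 : ℝ) 1) (z : ℂ) (j : Fin 3) :
    aeval z (S.phiPoly x j) = S.phi z x j := by
  have hdrift : ∀ t : ℝ, aeval z (drift t (![0, 0, 1] : Fin 3 → ℝ[X]) j) =
      drift t (![0, 0, 1] : Fin 3 → ℂ) j := fun t => by
    rw [drift_impulse_eq_algebraMap (A := ℂ), drift_impulse_eq_algebraMap, AlgHom.commutes]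
  rw [(S.phi_spec z).1.eq_drift_zero_add_sum hx, (S.phi_spec z).2]
  simp only [phiPoly, Pi.add_apply, Finset.sum_apply, Pi.smul_apply, smul_eq_mul, map_add, map_sum,
    map_mul, hdrift]
  congr 1
  refine Finset.sum_congr rfl fun i _ => ?_
  split_ifs <;> simp [aeval_massPoly, mul_comm z]

theorem phiPoly_zero (S : CubicString n) : S.phiPoly 0 = ![0, 0, 1] := by
  simp [phiPoly, (S.pos_pos _).not_ge, drift_apply]

theorem phiPoly_step (hab : S.IsGap a b) :
    S.phiPoly b = drift (b - a) (S.phiPoly a) +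
      ![0, 0, -(S.g.real {b} • (X * S.phiPoly b 0))] := by
  refine funext fun j => eq_of_forall_aeval_eq fun z => ?_
  rw [Pi.add_apply, map_add, map_drift, aeval_phiPoly S hab.mem_right, (S.phi_spec z).1.step hab]
  simp only [aeval_phiPoly S hab.mem_left, Pi.add_apply]
  congr 1
  fin_cases j
  · simp
  · simp
  · have hjump : aeval z (-(S.g.real {b} • (X * S.phiPoly b 0))) =
        -z * S.g.real {b} * S.phi z b 0 := by
      rw [map_neg, map_smul, map_mul, aeval_X, aeval_phiPoly S hab.mem_right, Complex.real_smul]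
      ring
    exact hjump.symm

theorem degree_phiPoly_one (S : CubicString n) {j : Fin 3} (hj : j = 2 ∨ ∀ i, S.pos i < 1) :
    (S.phiPoly 1 j).degree = n := by
  have hphi : S.phiPoly 1 j = C (drift 1 (![0, 0, 1] : Fin 3 → ℝ) j) +
      X * ∑ i with (i : Fin n).val < n,
        C (-(S.mass i * drift (1 - S.pos i) (![0, 0, 1] : Fin 3 → ℝ) j)) * S.massPoly i := by
    simp only [phiPoly, S.pos_le_one, if_true, Pi.add_apply, Finset.sum_apply, Pi.smul_apply,
      smul_eq_mul, drift_impulse_eq_algebraMap (A := ℝ[X]), algebraMap_eq, Finset.mul_sum,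
      Fin.is_lt, Finset.filter_true, map_neg, map_mul]
    congr 1
    exact Finset.sum_congr rfl fun i _ => by ring
  rw [hphi]
  refine degree_C_add_X_mul_sum le_rfl (fun k _ => S.degree_massPoly k) (fun k _ => ?_)
    fun _ => drift_impulse_ne_zero (Or.inr one_ne_zero)
  exact neg_ne_zero.2 (mul_ne_zero (S.mass_pos k).ne'
    (drift_impulse_ne_zero (hj.imp_right fun h => (sub_pos.2 (h k)).ne')))

theorem drift_adjointInit (t : ℝ) (j : Fin 3) :
    drift t (adjointInit j) 0 = drift t (![0, 0, 1] : Fin 3 → ℂ) j := by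
  fin_cases j <;> simp [drift_apply, adjointInit]

/-- The value `φ*_a(ξ; z)` as a polynomial in `z`, where `ξ` is the `j`-th mass counted from the
right end. -/
def adjointPoly (S : CubicString n) (a : Fin 3) : Fin n → ℝ[X] :=
  triangularPoly (fun j => drift (S.pos j.rev - 1) (![0, 0, 1] : Fin 3 → ℝ) a)
    fun j k => -(S.mass k.rev * (S.pos j.rev - S.pos k.rev) ^ 2 / 2)

theorem degree_adjointPoly (S : CubicString n) {a : Fin 3} (ha : a = 2 ∨ ∀ i, S.pos i < 1)
    (j : Fin n) : (S.adjointPoly a j).degree = (j : ℕ) :=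
  degree_triangularPoly
    (fun i => drift_impulse_ne_zero (ha.imp_right fun h => (sub_neg.2 (h i.rev)).ne))
    (fun i k hk => by
      have := sub_ne_zero.2 (S.pos_strictMono (Fin.rev_lt_rev.2 hk)).ne
      have := (S.mass_pos k.rev).ne'
      exact neg_ne_zero.2 (by positivity)) j

theorem aeval_adjointPoly (S : CubicString n) (a : Fin 3) (j : Fin n) (z : ℂ) :
    aeval z (S.adjointPoly a j) = S.phiStar a z (S.pos j.rev) 0 := by
  refine aeval_triangularPoly (c := fun j => S.phiStar a z (S.pos j.rev) 0) (fun i => ?_) j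
  rw [(S.phiStar_spec a z).1.apply_pos_eq_sum_Ioi, (S.phiStar_spec a z).2, drift_adjointInit,
    drift_impulse_eq_algebraMap, ← Fin.map_revPerm_Iio, Finset.sum_map, sub_eq_add_neg, ← mul_neg,
    ← Finset.sum_neg_distrib]
  simp

end SolutionPolynomials

section StieltjesForm

/-- An alternating form on the real polynomials that is positive in the way the two forms below
are: the values of `(f, g) ↦ Im (f(z) * conj g(z))` for `Im z > 0` detect zeros in the upper half
plane, those of the Wronskian `(f, g) ↦ (f' g - f g')(x)` at a real point detect the signs of
residues. -/
structure IsStieltjesForm (B : LinearMap.BilinForm ℝ ℝ[X]) : Prop where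
  alt : B.IsAlt
  X_mul_self_nonneg : ∀ f, 0 ≤ B (X * f) f
  X_one_pos : 0 < B X 1
  X_mul_X_mul_nonneg : ∀ f g, 0 ≤ B f g → 0 ≤ B (X * f) (X * g)

/-- The components `v 0, v 1, v 2` interlace, as seen by the form `B`. Both drifts and impulses
preserve this property, so it travels along the string. -/
structure Interlacing (B : LinearMap.BilinForm ℝ ℝ[X]) (v : Fin 3 → ℝ[X]) : Prop where
  nonneg : ∀ i j, i < j → 0 ≤ B (v i) (v j)
  X_mul_pos : ∀ i j, i < j → 0 < B (X * v i) (v j)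

theorem forall_lt_fin_three {P : Fin 3 → Fin 3 → Prop} :
    (∀ i j, i < j → P i j) ↔ P 0 1 ∧ P 0 2 ∧ P 1 2 := by
  refine ⟨fun h => ⟨h 0 1 (by decide), h 0 2 (by decide), h 1 2 (by decide)⟩, ?_⟩
  rintro ⟨h01, h02, h12⟩ i j hij
  fin_cases i <;> fin_cases j <;> first | assumption | exact absurd hij (by decide)

variable {B : LinearMap.BilinForm ℝ ℝ[X]} {v : Fin 3 → ℝ[X]}

theorem IsStieltjesForm.interlacing_const (hB : IsStieltjesForm B) {c : Fin 3 → ℝ}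
    (hc : ∀ i, 0 < c i) : Interlacing B (fun i => C (c i)) where
  nonneg i j _ := by
    rw [← mul_one (C (c i)), ← mul_one (C (c j)), ← smul_eq_C_mul, ← smul_eq_C_mul]
    simp [hB.alt 1]
  X_mul_pos i j _ := by
    rw [← mul_one (C (c j)), ← smul_eq_C_mul, mul_comm X, ← smul_eq_C_mul]
    simpa [mul_assoc] using mul_pos (hc j) (mul_pos (hc i) hB.X_one_pos)

theorem IsStieltjesForm.interlacing_drift (hB : IsStieltjesForm B) (hv : Interlacing B v) {l : ℝ}
    (hl : 0 < l) : Interlacing B (drift l v) := by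
  obtain ⟨pq, pr, qr⟩ := forall_lt_fin_three.1 hv.nonneg
  obtain ⟨Xpq, Xpr, Xqr⟩ := forall_lt_fin_three.1 hv.X_mul_pos
  have Xrr := hB.X_mul_self_nonneg (v 2)
  have Xqq := hB.X_mul_self_nonneg (v 1 + (l / 2) • v 2)
  have hqq := hB.alt (v 1)
  have hrr := hB.alt (v 2)
  have hrq := hB.alt.neg_eq (v 1) (v 2)
  constructor <;> refine forall_lt_fin_three.2 ⟨?_, ?_, ?_⟩
  · calc 0 ≤ B (v 0) (v 1) + l * B (v 0) (v 2) + l ^ 2 / 2 * B (v 1) (v 2) := by positivity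
      _ = _ := by
        simp only [drift_apply, Matrix.cons_val, map_add, map_smul, LinearMap.add_apply,
          LinearMap.smul_apply, smul_eq_mul, hqq, hrr, ← hrq]
        ring
  · calc 0 ≤ B (v 0) (v 2) + l * B (v 1) (v 2) := by positivity
      _ = _ := by simp [drift_apply, hrr]
  · simpa [drift_apply, hrr] using qr
  · calc 0 < B (X * v 0) (v 1) + l * B (X * v 0) (v 2) + l ^ 2 / 2 * B (X * v 1) (v 2) +
          l * B (X * (v 1 + (l / 2) • v 2)) (v 1 + (l / 2) • v 2) +
          l ^ 3 / 4 * B (X * v 2) (v 2) := by positivity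
      _ = _ := by
        simp only [drift_apply, Matrix.cons_val, mul_add, Algebra.mul_smul_comm, map_add, map_smul,
          LinearMap.add_apply, LinearMap.smul_apply, smul_eq_mul]
        ring
  · calc 0 < B (X * v 0) (v 2) + l * B (X * v 1) (v 2) + l ^ 2 / 2 * B (X * v 2) (v 2) := by
          positivity
      _ = _ := by simp [drift_apply, mul_add]
  · calc 0 < B (X * v 1) (v 2) + l * B (X * v 2) (v 2) := by positivity
      _ = _ := by simp [drift_apply, mul_add]

theorem IsStieltjesForm.interlacing_sub_smul_X_mul (hB : IsStieltjesForm B)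
    (hv : Interlacing B v) {c : ℝ} (hc : 0 ≤ c) :
    Interlacing B (v + ![0, 0, -(c • (X * v 0))]) := by
  obtain ⟨pq, pr, qr⟩ := forall_lt_fin_three.1 hv.nonneg
  obtain ⟨Xpq, Xpr, Xqr⟩ := forall_lt_fin_three.1 hv.X_mul_pos
  have Xpp := hB.X_mul_self_nonneg (v 0)
  have XpXq := hB.X_mul_X_mul_nonneg _ _ pq
  constructor <;> refine forall_lt_fin_three.2 ⟨?_, ?_, ?_⟩
  · simpa using pq
  · calc 0 ≤ B (v 0) (v 2) + c * B (X * v 0) (v 0) := by positivity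
      _ = _ := by simp [← hB.alt.neg_eq (X * v 0) (v 0)]
  · calc 0 ≤ B (v 1) (v 2) + c * B (X * v 0) (v 1) := by positivity
      _ = _ := by simp [← hB.alt.neg_eq (X * v 0) (v 1)]
  · simpa using Xpq
  · simpa [hB.alt (X * v 0)] using Xpr
  · calc 0 < B (X * v 1) (v 2) + c * B (X * v 0) (X * v 1) := by positivity
      _ = _ := by simp [← hB.alt.neg_eq (X * v 0) (X * v 1)]

theorem interlacing_phiPoly (S : CubicString n) (hB : IsStieltjesForm B) :
    ∀ x ∈ Set.Ioc (0 : ℝ) 1, Interlacing B (S.phiPoly x) := by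
  have hstep : ∀ a b, S.IsGap a b → Interlacing B (drift (b - a) (S.phiPoly a)) →
      Interlacing B (S.phiPoly b) := fun a b hab h => by
    have hb : S.phiPoly b 0 = drift (b - a) (S.phiPoly a) 0 := by
      rw [phiPoly_step hab]
      simp
    rw [phiPoly_step hab, hb]
    exact hB.interlacing_sub_smul_X_mul h measureReal_nonneg
  refine S.isGap_induction_Ioc (fun b hb => hstep 0 b hb ?_) fun a b hab ih =>
    hstep a b hab (hB.interlacing_drift ih (sub_pos.2 hab.lt))
  have hconst := hB.interlacing_const (c := drift b ![0, 0, 1]) (drift_impulse_pos hb.lt)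
  rw [phiPoly_zero, sub_zero]
  convert hconst using 1
  exact funext fun i => drift_impulse_eq_algebraMap b i

/-- The form `(f, g) ↦ Im (f(z) * conj g(z))`, used to exclude nonreal eigenvalues. -/
def imForm (z : ℂ) : LinearMap.BilinForm ℝ ℝ[X] :=
  LinearMap.mk₂ ℝ (fun f g => (aeval z f * conj (aeval z g)).im)
    (fun f f' g => by simp [add_mul]) (fun c f g => by simp [mul_assoc])
    (fun f g g' => by simp [mul_add]) (fun c f g => by simp [mul_left_comm])

theorem imForm_apply (z : ℂ) (f g : ℝ[X]) :
    imForm z f g = (aeval z f * conj (aeval z g)).im :=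
  rfl

theorem isStieltjesForm_imForm {z : ℂ} (hz : 0 < z.im) : IsStieltjesForm (imForm z) where
  alt f := by simp [imForm_apply, Complex.mul_conj]
  X_mul_self_nonneg f := by
    rw [imForm_apply, map_mul, aeval_X, mul_assoc, Complex.mul_conj, Complex.im_mul_ofReal]
    exact mul_nonneg hz.le (Complex.normSq_nonneg _)
  X_one_pos := by simpa [imForm_apply] using hz
  X_mul_X_mul_nonneg f g h := by
    have hmul : imForm z (X * f) (X * g) = Complex.normSq z * imForm z f g := by
      simp only [imForm_apply, map_mul, aeval_X]
      rw [mul_mul_mul_comm, Complex.mul_conj, Complex.im_ofReal_mul]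
    rw [hmul]
    exact mul_nonneg (Complex.normSq_nonneg z) h

/-- The Wronskian form `(f, g) ↦ (f' g - f g')(x)`, used for the signs of the weights. -/
def wronskianForm (x : ℝ) : LinearMap.BilinForm ℝ ℝ[X] :=
  -(wronskianBilin ℝ).compr₂ (leval x)

theorem wronskianForm_apply (x : ℝ) (f g : ℝ[X]) : wronskianForm x f g =
    (derivative f).eval x * g.eval x - f.eval x * (derivative g).eval x := by
  simp [wronskianForm, wronskian]

theorem isStieltjesForm_wronskianForm (x : ℝ) : IsStieltjesForm (wronskianForm x) where
  alt f := by simp [wronskianForm_apply, mul_comm]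
  X_mul_self_nonneg f := by
    have hsq : wronskianForm x (X * f) f = f.eval x ^ 2 := by
      simp only [wronskianForm_apply, derivative_mul, derivative_X, one_mul, eval_add, eval_mul,
        eval_X]
      ring
    exact hsq ▸ sq_nonneg _
  X_one_pos := by simp [wronskianForm_apply]
  X_mul_X_mul_nonneg f g h := by
    have hmul : wronskianForm x (X * f) (X * g) = x ^ 2 * wronskianForm x f g := by
      simp only [wronskianForm_apply, derivative_mul, derivative_X, one_mul, eval_add, eval_mul,
        eval_X]
      ring
    exact hmul ▸ mul_nonneg (sq_nonneg x) h

end StieltjesForm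

section Spectrum

variable {S : CubicString n} {i j : Fin 3} {z : ℂ}

theorem phi_one_eq_aeval (S : CubicString n) (z : ℂ) (j : Fin 3) :
    S.phi z 1 j = aeval z (S.phiPoly 1 j) :=
  (S.aeval_phiPoly (by simp) z j).symm

theorem phi_one_conj (S : CubicString n) (z : ℂ) (j : Fin 3) :
    S.phi (conj z) 1 j = conj (S.phi z 1 j) := by
  rw [phi_one_eq_aeval, phi_one_eq_aeval, aeval_conj]

theorem phi_one_ne_zero_of_im_pos (S : CubicString n) (hz : 0 < z.im) (j : Fin 3) :
    S.phi z 1 j ≠ 0 := by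
  intro hj
  have hpos := (S.interlacing_phiPoly (isStieltjesForm_imForm hz) 1 (by simp)).X_mul_pos
  simp only [imForm_apply, map_mul, ← phi_one_eq_aeval] at hpos
  rcases eq_or_ne j 0 with rfl | hj0
  · simpa [hj] using hpos 0 1 (by decide)
  · simpa [hj] using hpos 0 j (Fin.pos_of_ne_zero hj0)

theorem drift_pos {t : ℝ} (ht : 0 < t) {v : Fin 3 → ℝ} (hv : ∀ i, 0 < v i) (j : Fin 3) :
    0 < drift t v j := by
  have := hv 0
  have := hv 1
  have := hv 2
  have hval : 0 < v 0 + t * v 1 + t ^ 2 / 2 * v 2 := by positivity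
  have hslope : 0 < v 1 + t * v 2 := by positivity
  fin_cases j <;> simpa [drift_apply]

theorem phiPoly_eval_pos (S : CubicString n) {x : ℝ} (hx : x ≤ 0) :
    ∀ t ∈ Set.Ioc (0 : ℝ) 1, ∀ j, 0 < (S.phiPoly t j).eval x := by
  have heval : ∀ (t : ℝ) (v : Fin 3 → ℝ[X]) (j : Fin 3),
      (drift t v j).eval x = drift t (fun i => (v i).eval x) j := fun t v j => by
    simpa only [coe_aeval_eq_eval] using map_drift (aeval x) t v j
  have hstep : ∀ a b, S.IsGap a b → (∀ j, 0 < (drift (b - a) (S.phiPoly a) j).eval x) →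
      ∀ j, 0 < (S.phiPoly b j).eval x := fun a b hab h j => by
    have hb : S.phiPoly b 0 = drift (b - a) (S.phiPoly a) 0 := by
      rw [phiPoly_step hab]
      simp
    have hjump : 0 ≤ -(S.g.real {b} * (x * (S.phiPoly b 0).eval x)) :=
      neg_nonneg.2 (mul_nonpos_of_nonneg_of_nonpos measureReal_nonneg
        (mul_nonpos_of_nonpos_of_nonneg hx (hb ▸ h 0).le))
    rw [phiPoly_step hab, Pi.add_apply, eval_add]
    refine add_pos_of_pos_of_nonneg (h j) ?_
    fin_cases j
    · simp
    · simp
    · simpa using hjump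
  refine S.isGap_induction_Ioc (fun b hb => hstep 0 b hb fun j => ?_) fun a b hab ih =>
    hstep a b hab fun j => heval _ _ j ▸ drift_pos (sub_pos.2 hab.lt) ih j
  rw [phiPoly_zero, sub_zero, drift_impulse_eq_algebraMap, algebraMap_eq, eval_C]
  exact drift_impulse_pos hb.lt j

theorem spectrum_pos (hz : z ∈ S.spectrum j) : 0 < z := by
  rw [mem_spectrum_iff] at hz
  have him : z.im = 0 := by
    by_contra hne
    rcases lt_or_gt_of_ne hne with hneg | hpos
    · refine S.phi_one_ne_zero_of_im_pos (z := conj z) (by simpa using hneg) j ?_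
      rw [phi_one_conj, hz, map_zero]
    · exact S.phi_one_ne_zero_of_im_pos hpos j hz
  refine Complex.pos_iff.2 ⟨?_, him.symm⟩
  by_contra! hre
  have hreal : z = algebraMap ℝ ℂ z.re := Complex.ext rfl him
  rw [phi_one_eq_aeval, hreal, aeval_algebraMap_apply_eq_algebraMap_eval, map_eq_zero] at hz
  exact (S.phiPoly_eval_pos hre 1 (by simp) j).ne' hz

theorem spectrum_eq_rootSet (S : CubicString n) (j : Fin 3) :
    S.spectrum j = (S.phiPoly 1 j).rootSet ℂ := by
  have hne : S.phiPoly 1 j ≠ 0 := fun h => by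
    simpa [h] using S.phiPoly_eval_pos le_rfl 1 (by simp) j
  ext z
  rw [mem_spectrum_iff, phi_one_eq_aeval, mem_rootSet_of_ne hne]

theorem finite_spectrum (S : CubicString n) (j : Fin 3) : (S.spectrum j).Finite :=
  S.spectrum_eq_rootSet j ▸ rootSet_finite _ _

instance (S : CubicString n) (j : Fin 3) : Fintype (S.spectrum j) :=
  (S.finite_spectrum j).fintype

theorem deriv_phi_one (S : CubicString n) (z : ℂ) (j : Fin 3) :
    deriv (fun z => S.phi z 1 j) z = aeval z (derivative (S.phiPoly 1 j)) := by
  simp only [phi_one_eq_aeval, Polynomial.deriv_aeval]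

theorem phiPoly_mul_add_wronskian_pos (S : CubicString n) (x : ℝ) (hij : i < j) :
    0 < (S.phiPoly 1 i).eval x * (S.phiPoly 1 j).eval x +
      x * ((derivative (S.phiPoly 1 i)).eval x * (S.phiPoly 1 j).eval x -
        (S.phiPoly 1 i).eval x * (derivative (S.phiPoly 1 j)).eval x) := by
  have hpos := (S.interlacing_phiPoly (isStieltjesForm_wronskianForm x) 1 (by simp)).X_mul_pos
    i j hij
  rw [wronskianForm_apply, derivative_mul, derivative_X, one_mul, eval_add, eval_mul, eval_mul,
    eval_X] at hpos
  linear_combination hpos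

theorem weight_aeval_ofReal (S : CubicString n) (j : Fin 3) (p : ℝ[X]) (x : ℝ) :
    S.weight j (fun z => aeval z p) x =
      ((p.eval x / (derivative (S.phiPoly 1 j)).eval x : ℝ) : ℂ) := by
  rw [weight, deriv_phi_one, Complex.ofReal_div, ← Complex.coe_algebraMap,
    aeval_algebraMap_apply_eq_algebraMap_eval, aeval_algebraMap_apply_eq_algebraMap_eval]

theorem exists_pos_isRoot (hz : z ∈ S.spectrum j) :
    ∃ x : ℝ, 0 < x ∧ (x : ℂ) = z ∧ (S.phiPoly 1 j).eval x = 0 := by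
  obtain ⟨x, hx, rfl⟩ := RCLike.pos_iff_exists_ofReal.1 (spectrum_pos hz)
  rw [mem_spectrum_iff, phi_one_eq_aeval] at hz
  refine ⟨x, hx, rfl, ?_⟩
  rwa [RCLike.ofReal_eq_complex_ofReal, ← Complex.coe_algebraMap,
    aeval_algebraMap_apply_eq_algebraMap_eval, map_eq_zero] at hz

theorem weight_pos_of_lt (hij : i < j) (hz : z ∈ S.spectrum i) :
    0 < S.weight i (fun z => S.phi z 1 j) z := by
  obtain ⟨x, hx, rfl, hroot⟩ := exists_pos_isRoot hz
  have hpos := S.phiPoly_mul_add_wronskian_pos x hij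
  rw [hroot, zero_mul, zero_mul, zero_add, sub_zero, mul_pos_iff_of_pos_left hx, mul_comm] at hpos
  simp only [phi_one_eq_aeval, weight_aeval_ofReal, Complex.zero_lt_real]
  exact (div_pos_iff.trans mul_pos_iff.symm).2 hpos

theorem weight_neg_pos_of_lt (hij : i < j) (hz : z ∈ S.spectrum j) :
    0 < S.weight j (fun z => -S.phi z 1 i) z := by
  obtain ⟨x, hx, rfl, hroot⟩ := exists_pos_isRoot hz
  have hpos := S.phiPoly_mul_add_wronskian_pos x hij
  rw [hroot, mul_zero, mul_zero, zero_add, zero_sub, mul_pos_iff_of_pos_left hx, ← neg_mul] at hpos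
  simp only [phi_one_eq_aeval, ← map_neg, weight_aeval_ofReal, Complex.zero_lt_real, eval_neg]
  exact (div_pos_iff.trans mul_pos_iff.symm).2 hpos

theorem weight_numA_pos (T : TypePair) (hz : z ∈ S.spectrum T.fst) :
    0 < S.weight T.fst (T.numA S) z := by
  cases T
  exacts [weight_pos_of_lt (by decide) hz, weight_pos_of_lt (by decide) hz,
    weight_pos_of_lt (by decide) hz, weight_neg_pos_of_lt (by decide) hz]

theorem weight_numB_pos (T : TypePair) (hz : z ∈ S.spectrum T.snd) :
    0 < S.weight T.snd (T.numB S) z := by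
  cases T
  exacts [weight_pos_of_lt (by decide) hz, weight_neg_pos_of_lt (by decide) hz,
    weight_neg_pos_of_lt (by decide) hz, weight_neg_pos_of_lt (by decide) hz]

theorem deriv_phi_one_ne_zero (hz : z ∈ S.spectrum j) : deriv (fun z => S.phi z 1 j) z ≠ 0 := by
  intro hderiv
  rcases eq_or_ne j 0 with rfl | hj
  · simpa [weight, hderiv] using weight_pos_of_lt (j := 1) (by decide) hz
  · simpa [weight, hderiv] using weight_neg_pos_of_lt (Fin.pos_of_ne_zero hj) hz

theorem card_spectrum (S : CubicString n) (hj : j = 2 ∨ ∀ i, S.pos i < 1) :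
    Fintype.card (S.spectrum j) = n := by
  have hsep : (S.phiPoly 1 j).Separable := by
    refine (isCoprime_iff_aeval_ne_zero_of_isAlgClosed ℝ ℂ _ _).2 fun z => ?_
    by_cases hz : z ∈ S.spectrum j
    · exact .inr (S.deriv_phi_one z j ▸ deriv_phi_one_ne_zero hz)
    · exact .inl (S.phi_one_eq_aeval z j ▸ mt mem_spectrum_iff.2 hz)
  calc Fintype.card (S.spectrum j) = Fintype.card ((S.phiPoly 1 j).rootSet ℂ) :=
        Fintype.card_congr (Equiv.setCongr (S.spectrum_eq_rootSet j))
    _ = (S.phiPoly 1 j).natDegree := card_rootSet_eq_natDegree hsep (IsAlgClosed.splits _)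
    _ = n := natDegree_eq_of_degree_eq_some (S.degree_phiPoly_one hj)

end Spectrum

section Fourier

variable {a : Fin 3}

theorem fourier_apply (S : CubicString n) (a : Fin 3) (f : ℝ → ℂ) (z : ℂ) :
    S.fourier a f z =
      (-1) ^ (a : ℕ) * ∑ i, S.mass i * (S.phiStar a z (S.pos i) 0 * f (S.pos i)) := by
  classical
  rw [fourier, setIntegral_g S _ _ measurableSet_Icc]
  simp only [S.pos_mem, if_true]

theorem concomitant_adjointInit (a : Fin 3) (v : Fin 3 → ℂ) :
    concomitant v (adjointInit a) = (-1) ^ (a : ℕ) * v a := by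
  fin_cases a <;> simp [concomitant, adjointInit]

theorem sub_mul_fourier_phi (S : CubicString n) (a : Fin 3) (z w : ℂ) :
    (z - w) * S.fourier a (fun ξ => S.phi z ξ 0) w = S.phi w 1 a - S.phi z 1 a := by
  have hlagrange : ∀ z, (-1) ^ (a : ℕ) * S.phi z 1 a = concomitant ![0, 0, 1] (S.phiStar a w 0) +
      (-z + w) * ∑ i, S.mass i * (S.phi z (S.pos i) 0 * S.phiStar a w (S.pos i) 0) := fun z => by
    have h := (S.phi_spec z).1.lagrange (S.phiStar_spec a w).1
    rwa [(S.phi_spec z).2, (S.phiStar_spec a w).2, concomitant_adjointInit] at h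
  have hsign : ((-1 : ℂ) ^ (a : ℕ)) * (-1) ^ (a : ℕ) = 1 := by rw [← mul_pow]; simp
  rw [fourier_apply]
  simp only [mul_comm (S.phiStar _ _ _ _)]
  linear_combination (-1) ^ (a : ℕ) * (hlagrange z - hlagrange w) +
    (S.phi w 1 a - S.phi z 1 a) * hsign

theorem fourier_phi_self (S : CubicString n) (a : Fin 3) (w : ℂ) :
    S.fourier a (fun ξ => S.phi w ξ 0) w = -deriv (fun z => S.phi z 1 a) w := by
  set G : ℂ → ℂ := fun z => S.fourier a (fun ξ => S.phi z ξ 0) w with hG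
  have hdiff : DifferentiableAt ℂ G w := by
    simp only [hG, fourier_apply, ← S.aeval_phiPoly (S.pos_mem _)]
    exact .const_mul (.fun_sum fun i _ => .const_mul
      (.const_mul (Polynomial.differentiableAt_aeval _) _) _) _
  have hphi : (fun z => S.phi z 1 a) = fun z => S.phi w 1 a - (z - w) * G z := by
    funext z
    rw [S.sub_mul_fourier_phi a z w, sub_sub_cancel]
  have hderiv := (((hasDerivAt_id' w).sub_const w).fun_mul hdiff.hasDerivAt).const_sub
    (S.phi w 1 a)
  rw [hphi, hderiv.deriv, sub_self, zero_mul, add_zero, one_mul, neg_neg]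

/-- The expansion `-∑ φ(ξ; z) p(z) / ∂_z φ^(a)(1; z)` over the eigenvalues `z` of type `a`, which
recovers a function at the point masses from its Fourier transform `p` of type `a`. -/
def inverseFourier (S : CubicString n) (a : Fin 3) (p : ℂ → ℂ) (ξ : ℝ) : ℂ :=
  -∑ z : S.spectrum a, S.phi z ξ 0 * S.weight a p z

theorem fourier_phi_spectrum (S : CubicString n) (a : Fin 3) (z w : S.spectrum a) :
    S.fourier a (fun ξ => S.phi z ξ 0) w =
      if z = w then -deriv (fun z => S.phi z 1 a) w else 0 := by
  split_ifs with h
  · rw [h, fourier_phi_self]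
  · have horth := S.sub_mul_fourier_phi a z w
    rw [mem_spectrum_iff.1 z.2, mem_spectrum_iff.1 w.2, sub_zero] at horth
    exact (mul_eq_zero.1 horth).resolve_left (sub_ne_zero.2 (mt Subtype.ext h))

theorem fourier_inverseFourier (S : CubicString n) (a : Fin 3) (p : ℂ → ℂ) (w : S.spectrum a) :
    S.fourier a (S.inverseFourier a p) w = p w := by
  calc S.fourier a (S.inverseFourier a p) w =
        -∑ z : S.spectrum a, S.fourier a (fun ξ => S.phi z ξ 0) w * S.weight a p z := by
        simp only [fourier_apply, inverseFourier, mul_neg, Finset.sum_neg_distrib, Finset.mul_sum,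
          Finset.sum_mul]
        rw [Finset.sum_comm]
        simp only [mul_assoc]
    _ = deriv (fun z => S.phi z 1 a) w * S.weight a p w := by
        simp [fourier_phi_spectrum]
    _ = p w := mul_div_cancel₀ _ (deriv_phi_one_ne_zero w.2)

/-- By `fourier_inverseFourier` the Fourier transform maps onto the functions on the spectrum,
and there are as many eigenvalues as point masses. -/
theorem eq_of_fourier_eq (S : CubicString n) (ha : a = 2 ∨ ∀ i, S.pos i < 1) {f h : ℝ → ℂ}
    (hfh : ∀ w : S.spectrum a, S.fourier a f w = S.fourier a h w) (k : Fin n) :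
    f (S.pos k) = h (S.pos k) := by
  let F : Matrix (S.spectrum a) (Fin n) ℂ := .of fun w i =>
    (-1) ^ (a : ℕ) * (S.mass i * S.phiStar a w (S.pos i) 0)
  have hF : ∀ f : ℝ → ℂ, F.mulVecLin (f ∘ S.pos) = fun w : S.spectrum a => S.fourier a f w := by
    intro f
    ext w
    simp [F, fourier_apply, Matrix.mulVec, dotProduct, Finset.mul_sum, mul_assoc]
  have hsurj : Function.Surjective F.mulVecLin := fun p => by
    let q : ℂ → ℂ := Function.extend Subtype.val p 0
    refine ⟨S.inverseFourier a q ∘ S.pos, funext fun w => ?_⟩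
    rw [congrFun (hF _) w, fourier_inverseFourier]
    exact Subtype.val_injective.extend_apply p 0 w
  have hinj : Function.Injective F.mulVecLin := by
    refine (LinearMap.injective_iff_surjective_of_finrank_eq_finrank ?_).2 hsurj
    rw [Module.finrank_fintype_fun_eq_card, Module.finrank_fintype_fun_eq_card,
      S.card_spectrum ha, Fintype.card_fin]
  exact congrFun (hinj (a₁ := f ∘ S.pos) (a₂ := h ∘ S.pos)
    (by rw [hF, hF]; exact funext hfh)) k

theorem inverseFourier_fourier (S : CubicString n) (ha : a = 2 ∨ ∀ i, S.pos i < 1) (f : ℝ → ℂ)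
    (k : Fin n) : S.inverseFourier a (S.fourier a f) (S.pos k) = f (S.pos k) :=
  S.eq_of_fourier_eq ha (fun w => S.fourier_inverseFourier a _ w) k

end Fourier

section Parseval

variable {S : CubicString n} {a : Fin 3}

theorem integral_spectralMeasure {N : ℂ → ℂ} (hN : ∀ z ∈ S.spectrum a, 0 ≤ S.weight a N z)
    (f : ℂ → ℂ) : ∫ x : ℝ, f x ∂(S.spectralMeasure a N) =
      ∑ z : S.spectrum a, S.weight a N z * f z := by
  let e : {x : ℝ // (x : ℂ) ∈ S.spectrum a} ≃ S.spectrum a :=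
    .ofBijective (fun x => ⟨x, x.2⟩) ⟨fun x y h => Subtype.ext (by simpa using h), fun z => by
      obtain ⟨x, -, hx, -⟩ := exists_pos_isRoot z.2
      exact ⟨⟨x, hx ▸ z.2⟩, Subtype.ext hx⟩⟩
  let _ : Fintype {x : ℝ // (x : ℂ) ∈ S.spectrum a} := .ofEquiv _ e.symm
  rw [spectralMeasure, Measure.sum_fintype, integral_finsetSum_measure, ← e.sum_comp]
  · refine Finset.sum_congr rfl fun x _ => ?_
    have hx := Complex.nonneg_iff.1 (hN x x.2)
    have hre : ((S.weight a N x).re : ℂ) = S.weight a N x := Complex.ext rfl hx.2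
    rw [integral_smul_measure, integral_dirac, ENNReal.toReal_ofReal hx.1, Complex.real_smul, hre]
    rfl
  · exact fun x _ => (integrable_dirac (by simp)).smul_measure ENNReal.ofReal_ne_top

theorem numA_mul_numB (T : TypePair) {x y : ℂ} (hx : x ∈ S.spectrum T.fst)
    (hy : y ∈ S.spectrum T.snd) :
    T.numA S x * T.numB S y =
      (x + y) * ∑ k, S.mass k * (S.phi x (S.pos k) 0 * S.phi y (S.pos k) 0) := by
  have h := (S.phi_spec x).1.lagrange (S.phi_spec y).1
  rw [(S.phi_spec x).2, (S.phi_spec y).2] at h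
  simp only [concomitant, Matrix.cons_val, mul_zero, sub_zero] at h
  rw [mem_spectrum_iff] at hx hy
  cases T <;> simp only [TypePair.fst, TypePair.snd, TypePair.numA, TypePair.numB] at hx hy ⊢ <;>
    rw [hx, hy] at h <;> linear_combination -h

theorem weight_numA_mul_weight_numB (T : TypePair) (p q : ℂ → ℂ) {x y : ℂ}
    (hx : x ∈ S.spectrum T.fst) (hy : y ∈ S.spectrum T.snd) :
    S.weight T.fst (T.numA S) x * (S.weight T.snd (T.numB S) y * (p x * q y / (x + y))) =
      ∑ k, S.mass k * ((S.phi x (S.pos k) 0 * S.weight T.fst p x) *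
        (S.phi y (S.pos k) 0 * S.weight T.snd q y)) := by
  have hne : x + y ≠ 0 := (add_pos (spectrum_pos hx) (spectrum_pos hy)).ne'
  calc _ = T.numA S x * T.numB S y / (x + y) * (S.weight T.fst p x * S.weight T.snd q y) := by
        simp only [weight]
        ring
    _ = _ := by
        rw [numA_mul_numB T hx hy, mul_div_cancel_left₀ _ hne, Finset.sum_mul]
        exact Finset.sum_congr rfl fun k _ => by ring

theorem pairing_eq_integral_inverseFourier (S : CubicString n) (T : TypePair) (p q : ℂ → ℂ) :
    S.pairing T p q =
      ∫ ξ, S.inverseFourier T.fst p ξ * S.inverseFourier T.snd q ξ ∂S.g := by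
  rw [pairing, alpha, beta, integral_g]
  have hinner : ∀ x : ℂ, ∫ y : ℝ, p x * q y / (x + y) ∂S.spectralMeasure T.snd (T.numB S) =
      ∑ y : S.spectrum T.snd, S.weight T.snd (T.numB S) y * (p x * q y / (x + y)) := fun x =>
    integral_spectralMeasure (fun y hy => (weight_numB_pos T hy).le) fun y => p x * q y / (x + y)
  simp only [hinner]
  rw [integral_spectralMeasure (fun x hx => (weight_numA_pos T hx).le) fun x =>
    ∑ y : S.spectrum T.snd, S.weight T.snd (T.numB S) y * (p x * q y / (x + y))]
  simp only [Finset.mul_sum, weight_numA_mul_weight_numB T p q (Subtype.prop _) (Subtype.prop _)]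
  rw [Finset.sum_congr rfl fun x _ => Finset.sum_comm, Finset.sum_comm]
  simp only [inverseFourier, neg_mul_neg, Finset.sum_mul_sum, ← Finset.mul_sum]

theorem pairing_fourier (S : CubicString n) {T : TypePair} (ha : T.fst = 2 ∨ ∀ i, S.pos i < 1)
    (hb : T.snd = 2 ∨ ∀ i, S.pos i < 1) (f h : ℝ → ℂ) :
    S.pairing T (S.fourier T.fst f) (S.fourier T.snd h) = ∫ ξ, f ξ * h ξ ∂S.g := by
  rw [pairing_eq_integral_inverseFourier]
  simp only [integral_g, S.inverseFourier_fourier ha, S.inverseFourier_fourier hb]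

end Parseval

section Window

variable {S : CubicString n} {ε : ℝ}

theorem chi_apply_pos (hε : 0 < ε)
    (hdisj : Pairwise fun i j => Disjoint (S.window ε i) (S.window ε j)) (j k : Fin n) :
    S.chi ε j (S.pos k) = if k = j.rev then 1 else 0 := by
  have hmem : S.pos k ∈ S.window ε k.rev := by
    rw [window, Fin.rev_rev]
    exact ⟨sub_lt_self _ hε, lt_add_of_pos_right _ hε⟩
  split_ifs with h
  · rw [h, Fin.rev_rev] at hmem
    exact Set.indicator_of_mem (h ▸ hmem) _
  · have hne : k.rev ≠ j := fun hkj => h (Fin.rev_eq_iff.1 hkj)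
    exact Set.indicator_of_notMem (Set.disjoint_left.1 (hdisj hne) hmem) _

theorem exists_fourier_chi_eq_aeval {a : Fin 3} (ha : a = 2 ∨ ∀ i, S.pos i < 1) (hε : 0 < ε)
    (hdisj : Pairwise fun i j => Disjoint (S.window ε i) (S.window ε j)) (j : Fin n) :
    ∃ p : ℝ[X], p.degree = (j : ℕ) ∧ ∀ z : ℂ, S.fourier a (S.chi ε j) z = aeval z p := by
  refine ⟨C ((-1) ^ (a : ℕ) * S.mass j.rev) * S.adjointPoly a j, ?_, fun z => ?_⟩
  · rw [degree_C_mul, S.degree_adjointPoly ha]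
    exact mul_ne_zero (pow_ne_zero _ (by norm_num)) (S.mass_pos _).ne'
  · rw [fourier_apply, map_mul, aeval_C, S.aeval_adjointPoly]
    simp [chi_apply_pos hε hdisj, mul_assoc]

theorem pairing_fourier_chi {T : TypePair} (ha : T.fst = 2 ∨ ∀ i, S.pos i < 1)
    (hb : T.snd = 2 ∨ ∀ i, S.pos i < 1) (hε : 0 < ε)
    (hdisj : Pairwise fun i j => Disjoint (S.window ε i) (S.window ε j))
    (i j : Fin n) :
    S.pairing T (S.fourier T.fst (S.chi ε i)) (S.fourier T.snd (S.chi ε j)) =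
      if i = j then (S.mass i.rev : ℂ) else 0 := by
  rw [S.pairing_fourier ha hb, integral_g]
  rcases eq_or_ne i j with rfl | hij
  · simp [chi_apply_pos hε hdisj]
  · simp [chi_apply_pos hε hdisj, Fin.rev_inj, hij, hij.symm]

end Window

end CubicString

end

theorem mainTheorem3 {n : ℕ} (S : CubicString n) (T : TypePair)
    (hT : (∀ i, S.pos i < 1) ∨ T = TypePair.t22)
    (ε : ℝ) (hε : 0 < ε) (hdisj : Pairwise fun i j => Disjoint (S.window ε i) (S.window ε j)) :
    -- the discrete measures are genuine: real positive eigenvalues with positive weights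
    ((S.spectrum T.fst).Finite ∧ ∀ z ∈ S.spectrum T.fst, ∃ x A : ℝ, 0 < x ∧ 0 < A ∧
      z = x ∧ S.weight T.fst (T.numA S) z = A) ∧
    ((S.spectrum T.snd).Finite ∧ ∀ z ∈ S.spectrum T.snd, ∃ y B : ℝ, 0 < y ∧ 0 < B ∧
      z = y ∧ S.weight T.snd (T.numB S) z = B) ∧
    -- the transforms are polynomials of degree `j`
    (∀ j : Fin n, ∃ p : Polynomial ℝ, p.degree = (j : ℕ) ∧
      ∀ z : ℂ, S.fourier T.fst (S.chi ε j) z = Polynomial.aeval z p) ∧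
    (∀ j : Fin n, ∃ q : Polynomial ℝ, q.degree = (j : ℕ) ∧
      ∀ z : ℂ, S.fourier T.snd (S.chi ε j) z = Polynomial.aeval z q) ∧
    -- biorthogonality
    (∀ i j : Fin n, i ≠ j →
      S.pairing T (S.fourier T.fst (S.chi ε i)) (S.fourier T.snd (S.chi ε j)) = 0) ∧
    (∀ i : Fin n,
      S.pairing T (S.fourier T.fst (S.chi ε i)) (S.fourier T.snd (S.chi ε i)) ≠ 0) := by
  have ha : T.fst = 2 ∨ ∀ i, S.pos i < 1 := hT.symm.imp_left fun h => by rw [h]; rfl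
  have hb : T.snd = 2 ∨ ∀ i, S.pos i < 1 := hT.symm.imp_left fun h => by rw [h]; rfl
  refine ⟨⟨S.finite_spectrum _, fun z hz => ?_⟩, ⟨S.finite_spectrum _, fun z hz => ?_⟩,
    CubicString.exists_fourier_chi_eq_aeval ha hε hdisj,
    CubicString.exists_fourier_chi_eq_aeval hb hε hdisj, fun i j hij => ?_, fun i => ?_⟩
  · obtain ⟨x, hx, hxz⟩ := RCLike.pos_iff_exists_ofReal.1 (CubicString.spectrum_pos hz)
    obtain ⟨A, hA, hAz⟩ := RCLike.pos_iff_exists_ofReal.1 (CubicString.weight_numA_pos T hz)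
    exact ⟨x, A, hx, hA, hxz.symm, hAz.symm⟩
  · obtain ⟨y, hy, hyz⟩ := RCLike.pos_iff_exists_ofReal.1 (CubicString.spectrum_pos hz)
    obtain ⟨B, hB, hBz⟩ := RCLike.pos_iff_exists_ofReal.1 (CubicString.weight_numB_pos T hz)
    exact ⟨y, B, hy, hB, hyz.symm, hBz.symm⟩
  · rw [CubicString.pairing_fourier_chi ha hb hε hdisj, if_neg hij]
  · rw [CubicString.pairing_fourier_chi ha hb hε hdisj, if_pos rfl]
    exact Complex.ofReal_ne_zero.2 (S.mass_pos _).ne'
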